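/- Let $A\in\mathbb R^{n\times n}$, $B\in\mathbb R^{n\times p}$, $C\in\mathbb R^{q\times n}$, let $\|\cdot\|_F$ be the Frobenius norm, and let $$\mathcal R(X)=AX+XA^T-XBB^TX+C^TC .$$ Assume $A<0$, i.e. the field of values $\{\mu\in\mathbb C: z^*(A-\mu I)z=0 \text{ for some } z\in\mathbb C^n,\ \|z\|=1\}$ lies in the open left half plane (in particular $A$ is stable, so $(A,B)$ is stabilizable and $(C,A)$ is detectable). Let $\mathcal K_m$ ($m\ge 1$) be either the extended block Krylov subspaces $\mathrm{Range}[C^T,A^{-1}C^T,AC^T,A^{-2}C^T,\dots,A^{m-1}C^T,A^{-m}C^T]$ or the rational block Krylov subspaces $\mathrm{Range}[C^T,(A-s_2I)^{-1}C^T,\dots,\prod_{i=2}^m(A-s_iI)^{-1}C^T]$ with shifts $s_i\in\mathbb C$ that are not eigenvalues of $A$. Let $(X_k)_{k\ge0}$ be an infinite sequence produced by the projected Newton-Kleinman method with exact line search, i.e. $X_0=0$, $0<\bar\eta<1$, and for every $k\ge 0$, with indices $1\le\bar m_1\le \bar m_2\le\cdots$ and a real matrix $V_{\bar m_{k+1}}$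 with orthonormal columns spanning $\mathcal K_{\bar m_{k+1}}$ (over $\mathbb C$ in the rational case): * $\widetilde Y_{k+1}$ is a symmetric solution of the projected Lyapunov equation $Q\widetilde Y+\widetilde YQ^T=-V^T(X_kBB^TX_k+C^TC)V$, where $V=V_{\bar m_{k+1}}$ and $Q=V^T(A-X_kBB^T)V$; put $\widetilde X_{k+1}=V\widetilde Y_{k+1}V^T$ and $Z_k=\widetilde X_{k+1}-X_k$; * the residual $L_{k+1}=(A-X_kBB^T)\widetilde X_{k+1}+\widetilde X_{k+1}(A-X_kBB^T)^T+X_kBB^TX_k+C^TC$ satisfies $\|L_{k+1}\|_F\le\eta_k\|\mathcal R(X_k)\|_F$ with some $\eta_k\in(0,\bar\eta)$; * $X_{k+1}=X_k+\lambda_kZ_k$, where $\lambda_k\in(0,2]$ minimizes $\lambda\mapsto\|\mathcal R(X_k+\lambda Z_k)\|_F^2$ over $(0,2]$. Suppose that either * (i) $\mathrm{Ker}(C^TC)\subseteq\mathrm{Ker}(BB^T)$ and $\|L_{k+1}\|_F\le\sigma_{\min}(C)^2$ for all $k\ge 0$, or * (ii) $BB^T-C^TC$ is negative semidefinite and $\|L_{k+1}\|_F\le\sigma_{\min}(B)^2$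 for all $k\ge 0$, where $\sigma_{\min}$ denotes the smallest singular value (the smallest of the $\min(r,c)$ singular values of an $r\times c$ matrix). If there is $c>0$ with $\lambda_k\ge c$ for all $k$, then the residual norms decrease monotonically to zero: $\|\mathcal R(X_{k+1})\|_F\le\|\mathcal R(X_k)\|_F$ for all $k$, with strict inequality whenever $\mathcal R(X_k)\ne0$, and $\|\mathcal R(X_k)\|_F\to0$ as $k\to\infty$. -/

import Mathlib

open Filter Topology
open scoped Matrix

-- The norm on matrices is the Frobenius norm throughout.
open scoped Matrix.Norms.Frobenius

noncomputable section

namespace RiccatiPNK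

variable {n p q : ℕ}

/-- The Riccati operator `R(X) = A X + X Aᵀ - X B Bᵀ X + Cᵀ C`. -/
def riccati (A : Matrix (Fin n) (Fin n) ℝ) (B : Matrix (Fin n) (Fin p) ℝ)
    (C : Matrix (Fin q) (Fin n) ℝ) (X : Matrix (Fin n) (Fin n) ℝ) : Matrix (Fin n) (Fin n) ℝ :=
  A * X + X * Aᵀ - X * B * Bᵀ * X + Cᵀ * C

/-- The residual of `W` in the Newton-Kleinman (Lyapunov) equation at `X`, that is
`(A - X B Bᵀ) W + W (A - X B Bᵀ)ᵀ + X B Bᵀ X + Cᵀ C`. -/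
def newtonResidual (A : Matrix (Fin n) (Fin n) ℝ) (B : Matrix (Fin n) (Fin p) ℝ)
    (C : Matrix (Fin q) (Fin n) ℝ) (X W : Matrix (Fin n) (Fin n) ℝ) :
    Matrix (Fin n) (Fin n) ℝ :=
  (A - X * B * Bᵀ) * W + W * (A - X * B * Bᵀ)ᵀ + X * B * Bᵀ * X + Cᵀ * C

/-- The field of values `W(A) = {μ : z* (A - μ I) z = 0 for some z ∈ ℂⁿ, ‖z‖ = 1}`. -/
def fieldOfValues (A : Matrix (Fin n) (Fin n) ℝ) : Set ℂ :=
  {μ | ∃ z : Fin n → ℂ, star z ⬝ᵥ z = 1 ∧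
    star z ⬝ᵥ ((A.map Complex.ofReal - μ • (1 : Matrix (Fin n) (Fin n) ℂ)) *ᵥ z) = 0}

/-- `A < 0`: the field of values lies in the open left half plane (`A` need not be symmetric). -/
def IsNegDef (A : Matrix (Fin n) (Fin n) ℝ) : Prop :=
  fieldOfValues A ⊆ {μ : ℂ | μ.re < 0}

/-- The smallest of the `min r c` singular values of an `r × c` matrix. (Mathlib's sequence
`singularValues` is zero-indexed and decreasing.) -/
def smallestSingularValue {r c : ℕ} (M : Matrix (Fin r) (Fin c) ℝ) : ℝ :=
  (Matrix.toEuclideanLin M).singularValues (min r c - 1)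

/-- The extended block Krylov subspace
`Range [Cᵀ, A⁻¹ Cᵀ, A Cᵀ, A⁻² Cᵀ, …, A^(m-1) Cᵀ, A^(-m) Cᵀ]`. -/
def extendedKrylov (A : Matrix (Fin n) (Fin n) ℝ) (C : Matrix (Fin q) (Fin n) ℝ) (m : ℕ) :
    Submodule ℝ (Fin n → ℝ) :=
  ⨆ i : Fin m, LinearMap.range (A ^ (i : ℕ) * Cᵀ).mulVecLin ⊔
    LinearMap.range (A⁻¹ ^ ((i : ℕ) + 1) * Cᵀ).mulVecLin

/-- `shiftedInverse A s j = ∏_{i=2}^{j+1} (A - s_i I)⁻¹`; the factors commute. -/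
def shiftedInverse (A : Matrix (Fin n) (Fin n) ℝ) (s : ℕ → ℂ) : ℕ → Matrix (Fin n) (Fin n) ℂ
  | 0 => 1
  | j + 1 => (A.map Complex.ofReal - s (j + 2) • (1 : Matrix (Fin n) (Fin n) ℂ))⁻¹ *
      shiftedInverse A s j

/-- The rational block Krylov subspace
`Range [Cᵀ, (A - s₂ I)⁻¹ Cᵀ, …, ∏_{i=2}^m (A - s_i I)⁻¹ Cᵀ]`, a subspace of `ℂⁿ`. -/
def rationalKrylov (A : Matrix (Fin n) (Fin n) ℝ) (C : Matrix (Fin q) (Fin n) ℝ) (s : ℕ → ℂ)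
    (m : ℕ) : Submodule ℂ (Fin n → ℂ) :=
  ⨆ j : Fin m, LinearMap.range (shiftedInverse A s j * (C.map Complex.ofReal)ᵀ).mulVecLin

/-- The two families of approximation spaces: extended Krylov, and rational Krylov with shifts
`s₂, s₃, …`. -/
inductive SpaceKind : Type
  | extended : SpaceKind
  | rational (s : ℕ → ℂ) : SpaceKind

/-- The columns of the real matrix `V` span the `m`-th approximation space. In the rational case
the shifts may be complex (in conjugate pairs), and the complex span is meant; the shifts are not
eigenvalues of `A`. -/
def Spans (A : Matrix (Fin n) (Fin n) ℝ) (C : Matrix (Fin q) (Fin n) ℝ) {d : ℕ} :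
    SpaceKind → ℕ → Matrix (Fin n) (Fin d) ℝ → Prop
  | SpaceKind.extended, m, V => LinearMap.range V.mulVecLin = extendedKrylov A C m
  | SpaceKind.rational s, m, V =>
      (∀ i, 2 ≤ i → IsUnit (A.map Complex.ofReal - s i • (1 : Matrix (Fin n) (Fin n) ℂ))) ∧
      LinearMap.range (V.map Complex.ofReal).mulVecLin = rationalKrylov A C s m

/-- An infinite sequence produced by the projected Newton-Kleinman method with exact line search,
started at `X₀ = 0`. In step `k` the Newton equation at `X_k` is projected onto the approximation
space of index `m k`, with orthonormal basis `V k`. -/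
structure ProjectedNewtonKleinman (A : Matrix (Fin n) (Fin n) ℝ) (B : Matrix (Fin n) (Fin p) ℝ)
    (C : Matrix (Fin q) (Fin n) ℝ) : Type where
  /-- extended or rational Krylov -/
  kind : SpaceKind
  /-- index of the approximation space used in step `k` -/
  m : ℕ → ℕ
  m_pos : ∀ k, 1 ≤ m k
  m_mono : Monotone m
  /-- dimension of that space -/
  dim : ℕ → ℕ
  /-- its orthonormal basis -/
  V : (k : ℕ) → Matrix (Fin n) (Fin (dim k)) ℝ
  V_orthonormal : ∀ k, (V k)ᵀ * V k = 1
  V_spans : ∀ k, Spans A C kind (m k) (V k)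
  /-- the iterates -/
  X : ℕ → Matrix (Fin n) (Fin n) ℝ
  X_zero : X 0 = 0
  /-- the symmetric solution of the projected Lyapunov equation -/
  Y : (k : ℕ) → Matrix (Fin (dim k)) (Fin (dim k)) ℝ
  Y_symm : ∀ k, (Y k).IsSymm
  Y_solves : ∀ k,
    ((V k)ᵀ * (A - X k * B * Bᵀ) * V k) * Y k +
      Y k * ((V k)ᵀ * (A - X k * B * Bᵀ) * V k)ᵀ =
    -((V k)ᵀ * (X k * B * Bᵀ * X k) * V k) - (V k)ᵀ * (Cᵀ * C) * V k
  /-- the forcing parameters -/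
  etaBar : ℝ
  etaBar_mem : etaBar ∈ Set.Ioo (0 : ℝ) 1
  eta : ℕ → ℝ
  eta_mem : ∀ k, eta k ∈ Set.Ioo (0 : ℝ) etaBar
  /-- acceptance test `‖L_{k+1}‖ ≤ η_k ‖R(X_k)‖` for `V_k Y_k V_kᵀ` -/
  accepted : ∀ k, ‖newtonResidual A B C (X k) (V k * Y k * (V k)ᵀ)‖ ≤
    eta k * ‖riccati A B C (X k)‖
  /-- the step sizes, given by the exact line search on `(0, 2]` -/
  lam : ℕ → ℝ
  lam_mem : ∀ k, lam k ∈ Set.Ioc (0 : ℝ) 2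
  lam_argmin : ∀ k, IsMinOn
    (fun t : ℝ => ‖riccati A B C (X k + t • (V k * Y k * (V k)ᵀ - X k))‖ ^ 2)
    (Set.Ioc (0 : ℝ) 2) (lam k)
  X_succ : ∀ k, X (k + 1) = X k + lam k • (V k * Y k * (V k)ᵀ - X k)

namespace ProjectedNewtonKleinman

variable {A : Matrix (Fin n) (Fin n) ℝ} {B : Matrix (Fin n) (Fin p) ℝ}
  {C : Matrix (Fin q) (Fin n) ℝ}

/-- `L k` is the Lyapunov residual `L_{k+1}` of the approximate Newton step taken at `X_k`. -/
def L (S : ProjectedNewtonKleinman A B C) (k : ℕ) : Matrix (Fin n) (Fin n) ℝ :=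
  newtonResidual A B C (S.X k) (S.V k * S.Y k * (S.V k)ᵀ)

end ProjectedNewtonKleinman

end RiccatiPNK

end

/-! Along $Z=W-X$ with $X$ symmetric, the residual is quadratic in the step: $\mathcal
R(X+tZ)=(1-t)\mathcal R(X)+tL-t^2P$, where $P=ZBB^TZ$ and $\|L\|\le\bar\eta\|\mathcal R(X)\|$. For
small $t$ the linear gain $(1-\bar\eta)t$ beats the quadratic term, so exact line search never
increases the residual. The danger is a huge $P$, which would make the gain negligible. But at the
accepted step $\lambda\ge c$ every other term of the expansion is $O(\|\mathcal R(X)\|)$, which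
forces $c^2\|P\|\le4\|\mathcal R(X)\|$. Comparing the minimizer with a fixed small trial step then
gives a contraction factor independent of $k$ (`norm_riccati_succ_le`), hence geometric decay. -/

namespace RiccatiPNK

variable {n p q : ℕ}

/-- Expansion of the Riccati operator along a Newton-Kleinman direction. -/
theorem riccati_add_smul_sub (A : Matrix (Fin n) (Fin n) ℝ) (B : Matrix (Fin n) (Fin p) ℝ)
    (C : Matrix (Fin q) (Fin n) ℝ) {X : Matrix (Fin n) (Fin n) ℝ} (hX : X.IsSymm)
    (W : Matrix (Fin n) (Fin n) ℝ) (t : ℝ) :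
    riccati A B C (X + t • (W - X)) =
      (1 - t) • riccati A B C X + t • newtonResidual A B C X W -
        t ^ 2 • ((W - X) * B * Bᵀ * (W - X)) := by
  simp only [riccati, newtonResidual, Matrix.transpose_sub, Matrix.transpose_mul,
    Matrix.transpose_transpose, hX.eq, Matrix.mul_add, Matrix.add_mul, Matrix.mul_sub,
    Matrix.sub_mul, Matrix.smul_mul, Matrix.mul_smul, Matrix.mul_assoc]
  module

namespace ProjectedNewtonKleinman

variable {A : Matrix (Fin n) (Fin n) ℝ} {B : Matrix (Fin n) (Fin p) ℝ}
  {C : Matrix (Fin q) (Fin n) ℝ}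

/-- The expansion needs $X^T=X$, because `newtonResidual` contains $(A-XBB^T)^T=A^T-BB^TX^T$. -/
theorem isSymm_X (S : ProjectedNewtonKleinman A B C) (k : ℕ) : (S.X k).IsSymm := by
  induction k with
  | zero => rw [S.X_zero]; exact Matrix.isSymm_zero
  | succ k ih =>
    have hW : (S.V k * S.Y k * (S.V k)ᵀ).IsSymm := by
      simp [Matrix.IsSymm, Matrix.transpose_mul, (S.Y_symm k).eq, Matrix.mul_assoc]
    rw [S.X_succ]
    exact ih.add ((hW.sub ih).smul _)

/-- If the step sizes are at least `c`, the residual norms contract by a fixed factor. -/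
theorem norm_riccati_succ_le (S : ProjectedNewtonKleinman A B C) {c : ℝ} (hc : 0 < c) (k : ℕ)
    (hck : c ≤ S.lam k) :
    ‖riccati A B C (S.X (k + 1))‖ ≤
      (1 - (1 - S.etaBar) ^ 2 * c ^ 2 / 16) * ‖riccati A B C (S.X k)‖ := by
  set W := S.V k * S.Y k * (S.V k)ᵀ
  set P := (W - S.X k) * B * Bᵀ * (W - S.X k)
  set r := ‖riccati A B C (S.X k)‖
  set r' := ‖riccati A B C (S.X (k + 1))‖ with hr'
  obtain ⟨hb0, hb1⟩ := S.etaBar_mem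
  obtain ⟨hl0, hl2⟩ := S.lam_mem k
  have hr0 : 0 ≤ r := norm_nonneg _
  have hP0 : 0 ≤ ‖P‖ := norm_nonneg _
  have hL : ‖newtonResidual A B C (S.X k) W‖ ≤ S.etaBar * r :=
    (S.accepted k).trans (mul_le_mul_of_nonneg_right (S.eta_mem k).2.le hr0)
  have hexp := riccati_add_smul_sub A B C (S.isSymm_X k) W
  have hmin : ∀ t : ℝ, 0 < t → t ≤ 2 → r' ≤ ‖riccati A B C (S.X k + t • (W - S.X k))‖ := by
    intro t h0 h2
    have h := isMinOn_iff.mp (S.lam_argmin k) t ⟨h0, h2⟩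
    rw [hr', S.X_succ]
    exact (sq_le_sq₀ (norm_nonneg _) (norm_nonneg _)).mp h
  have hbound : ∀ t : ℝ, 0 < t → t ≤ 1 →
      r' ≤ (1 - t) * r + t * (S.etaBar * r) + t ^ 2 * ‖P‖ := by
    intro t h0 h1
    refine (hmin t h0 (by linarith)).trans ?_
    rw [hexp]
    refine (norm_sub_le _ _).trans (add_le_add ((norm_add_le _ _).trans (add_le_add ?_ ?_)) ?_)
    · rw [norm_smul, Real.norm_of_nonneg (by linarith)]
    · rw [norm_smul, Real.norm_of_nonneg h0.le]
      exact mul_le_mul_of_nonneg_left hL h0.le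
    · rw [norm_smul, Real.norm_of_nonneg (by positivity)]
  have hmono : r' ≤ r := by
    -- The step $t=0$ is not admissible in the line search, so monotonicity comes from letting
    -- $t\to0^+$.
    have hlim : Tendsto (fun t : ℝ => r + t * ‖P‖) (𝓝[>] 0) (𝓝 r) := by
      have : Continuous fun t : ℝ => r + t * ‖P‖ := by fun_prop
      simpa using (this.tendsto 0).mono_left nhdsWithin_le_nhds
    refine ge_of_tendsto hlim ?_
    filter_upwards [Ioc_mem_nhdsGT (zero_lt_one' ℝ)] with t ht
    have h := hbound t ht.1 ht.2
    have h1 : t * (S.etaBar * r) ≤ t * r :=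
      mul_le_mul_of_nonneg_left (mul_le_of_le_one_left hr0 hb1.le) ht.1.le
    have h2 : t ^ 2 * ‖P‖ ≤ t * ‖P‖ :=
      mul_le_mul_of_nonneg_right (pow_le_of_le_one ht.1.le ht.2 two_ne_zero) hP0
    linarith
  have hPbound : c ^ 2 * ‖P‖ ≤ 4 * r := by
    -- The expansion at the accepted step, solved for $P$; below, $0<\lambda\le2$ gives
    -- $|1-\lambda|\le1$.
    have heq : S.lam k ^ 2 • P = (1 - S.lam k) • riccati A B C (S.X k) +
        S.lam k • newtonResidual A B C (S.X k) W - riccati A B C (S.X (k + 1)) := by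
      rw [S.X_succ, hexp]
      abel
    calc c ^ 2 * ‖P‖ ≤ S.lam k ^ 2 * ‖P‖ :=
        mul_le_mul_of_nonneg_right (pow_le_pow_left₀ hc.le hck 2) hP0
      _ = ‖S.lam k ^ 2 • P‖ := by rw [norm_smul, Real.norm_of_nonneg (by positivity)]
      _ ≤ 1 * r + 2 * (1 * r) + r := by
        rw [heq]
        refine (norm_sub_le _ _).trans
          (add_le_add ((norm_add_le _ _).trans (add_le_add ?_ ?_)) hmono)
        · rw [norm_smul]
          exact mul_le_mul_of_nonneg_right (abs_le.mpr ⟨by linarith, by linarith⟩) hr0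
        · rw [norm_smul, Real.norm_of_nonneg hl0.le]
          exact mul_le_mul hl2 (hL.trans (mul_le_mul_of_nonneg_right hb1.le hr0))
            (norm_nonneg _) zero_le_two
      _ = 4 * r := by ring
  have hc2 : c ^ 2 ≤ 4 := by nlinarith
  -- This trial step minimizes $1-(1-\bar\eta)t+4t^2/c^2$, with minimum value
  -- $1-(1-\bar\eta)^2c^2/16$. It is admissible because $c\le\lambda_k\le2$.
  have ht0 : 0 < (1 - S.etaBar) * c ^ 2 / 8 :=
    div_pos (mul_pos (by linarith) (by positivity)) (by norm_num)
  have ht1 : (1 - S.etaBar) * c ^ 2 / 8 ≤ 1 := by nlinarith [sq_nonneg c]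
  have h := hbound _ ht0 ht1
  have h' : ((1 - S.etaBar) * c ^ 2 / 8) ^ 2 * ‖P‖ ≤ (1 - S.etaBar) ^ 2 * c ^ 2 / 16 * r := by
    have := mul_le_mul_of_nonneg_left hPbound
      (show 0 ≤ (1 - S.etaBar) ^ 2 * c ^ 2 / 64 by positivity)
    linarith
  linarith

end ProjectedNewtonKleinman

end RiccatiPNK

theorem mainTheorem5 {n p q : ℕ} (A : Matrix (Fin n) (Fin n) ℝ) (B : Matrix (Fin n) (Fin p) ℝ)
    (C : Matrix (Fin q) (Fin n) ℝ) (hA : RiccatiPNK.IsNegDef A)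
    (S : RiccatiPNK.ProjectedNewtonKleinman A B C)
    (hS :
      (LinearMap.ker (Cᵀ * C).mulVecLin ≤ LinearMap.ker (B * Bᵀ).mulVecLin ∧
        ∀ k, ‖S.L k‖ ≤ RiccatiPNK.smallestSingularValue C ^ 2) ∨
      ((Cᵀ * C - B * Bᵀ).PosSemidef ∧
        ∀ k, ‖S.L k‖ ≤ RiccatiPNK.smallestSingularValue B ^ 2))
    (hlam : ∃ c : ℝ, 0 < c ∧ ∀ k, c ≤ S.lam k) :
    Antitone (fun k => ‖RiccatiPNK.riccati A B C (S.X k)‖) ∧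
    (∀ k, RiccatiPNK.riccati A B C (S.X k) ≠ 0 →
      ‖RiccatiPNK.riccati A B C (S.X (k + 1))‖ < ‖RiccatiPNK.riccati A B C (S.X k)‖) ∧
    Tendsto (fun k => ‖RiccatiPNK.riccati A B C (S.X k)‖) atTop (𝓝 0) := by

  obtain ⟨c, hc, hck⟩ := hlam
  obtain ⟨hb0, hb1⟩ := S.etaBar_mem
  set ρ : ℝ := 1 - (1 - S.etaBar) ^ 2 * c ^ 2 / 16 with hρ
  have hcontr : ∀ k, ‖RiccatiPNK.riccati A B C (S.X (k + 1))‖ ≤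
      ρ * ‖RiccatiPNK.riccati A B C (S.X k)‖ := fun k => S.norm_riccati_succ_le hc k (hck k)
  have hρ1 : ρ < 1 := by
    have : 0 < (1 - S.etaBar) ^ 2 * c ^ 2 / 16 :=
      div_pos (mul_pos (pow_pos (by linarith) 2) (by positivity)) (by norm_num)
    linarith
  -- Nonnegativity lets the contraction be iterated; $c\le2$ even gives $\rho\ge3/4$.
  have hρ0 : 0 ≤ ρ := by
    have h1 : c ^ 2 ≤ 4 := by nlinarith [(hck 0).trans (S.lam_mem 0).2]
    have h2 : (1 - S.etaBar) ^ 2 ≤ 1 := pow_le_one₀ (by linarith) (by linarith)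
    have h3 := mul_le_mul h2 h1 (by positivity) zero_le_one
    linarith
  refine ⟨antitone_nat_of_succ_le fun k =>
    (hcontr k).trans (mul_le_of_le_one_left (norm_nonneg _) hρ1.le), fun k hk =>
    (hcontr k).trans_lt (mul_lt_of_lt_one_left (norm_pos_iff.mpr hk) hρ1), ?_⟩
  have hgeom : ∀ k, ‖RiccatiPNK.riccati A B C (S.X k)‖ ≤
      ρ ^ k * ‖RiccatiPNK.riccati A B C (S.X 0)‖ := by
    intro k
    induction k with
    | zero => simp
    | succ k ih =>
      rw [pow_succ', mul_assoc]
      exact (hcontr k).trans (mul_le_mul_of_nonneg_left ih hρ0)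
  refine squeeze_zero (fun _ => norm_nonneg _) hgeom ?_
  simpa using (tendsto_pow_atTop_nhds_zero_of_lt_one hρ0 hρ1).mul_const
    ‖RiccatiPNK.riccati A B C (S.X 0)‖
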